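/- **Setting.** Let $n\ge 0$. An element of $L^2(\mathbb R^n)$ has bounded support if it vanishes a.e. outside a ball. For $F:L^2(\mathbb R^n)\to\mathbb R$ and $m\in L^2(\mathbb R^n)$, a function $g\in L^2_{loc}(\mathbb R^n)$ is the Gâteaux derivative $\frac{\partial F}{\partial m}(m)$ if $$\frac{d}{d\theta}F(m+\theta\tilde m)\Big|_{\theta=0}=\int_{\mathbb R^n} g(\xi)\tilde m(\xi)\,d\xi\qquad\text{for all boundedly supported }\tilde m\in L^2(\mathbb R^n).$$ The second derivative $\frac{\partial^2F}{\partial m^2}(m)(\xi,\cdot)$ is the Gâteaux derivative at $m$ of $m\mapsto\frac{\partial F}{\partial m}(m)(\xi)$, for each $\xi$. **Assumptions on $F$.** The derivatives $\frac{\partial F}{\partial m}(m)$ and $\frac{\partial^2F}{\partial m^2}(m)(\xi,\cdot)$ exist at all boundedly supported $m\in L^2(\mathbb R^n)$ and all $\xi\in\mathbb R^n$. The functions $F(m)$, $\frac{\partial F}{\partial m}(m)(\xi)$, $\frac{\partial^2F}{\partial m^2}(m)(\xi,\eta)$ extend from the boundedly supported probability densities $m\in L^2(\mathbb R^n)$ to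 probability measures $m$ on $\mathbb R^n$; the extensions are denoted by the same symbols. For boundedly supported probability measures $m$: $\frac{\partial F}{\partial m}(m)(\cdot)$ is $C^2$, and $D_\eta\frac{\partial^2F}{\partial m^2}(m)(\xi,\eta)$ and $D_\xi D_\eta\frac{\partial^2F}{\partial m^2}(m)(\xi,\eta)$ exist. For every $R$, on the set of $m$ carried by $\{|\xi|\le R\}$ (with weak convergence), $F$ is continuous in $m$; $\frac{\partial F}{\partial m}$, $D_\xi\frac{\partial F}{\partial m}$, $D_\xi^2\frac{\partial F}{\partial m}$ are jointly continuous in $(m,\xi)$; and $\frac{\partial^2F}{\partial m^2}$, $D_\eta\frac{\partial^2F}{\partial m^2}$, $D_\xi D_\eta\frac{\partial^2F}{\partial m^2}$ are jointly continuous in $(m,\xi,\eta)$. **Assumption on $\Phi$.** For every $K\ge1$, the function $$\Phi(x)=\Phi(x^1,\dots,x^K)=F\Big(\frac1K\sum_{j=1}^K\delta_{x^j}\Big)$$ is $C^2$ on $(\mathbb R^n)^K$. **Conclusion.** Write $m=\frac1K\sum_{j=1}^K\delta_{x^j}$. 1. For every $K\ge1$, every $x\in(\mathbb R^n)^K$ and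 every vector field $B:\mathbb R^n\to\mathbb R^n$, $$\int_{\mathbb R^n} D_\xi\frac{\partial F}{\partial m}(m)(\xi)\cdot B(\xi)\,m(d\xi)=\sum_{j=1}^K D_{x^j}\Phi(x)\cdot B(x^j).$$ 2. For every $K\ge1$ and every $x\in(\mathbb R^n)^K$, $$\int_{\mathbb R^n}\Delta_\xi\frac{\partial F}{\partial m}(m)(\xi)\,m(d\xi)+\int_{\mathbb R^n}\!\int_{\mathbb R^n}\operatorname{tr}D_\xi D_\eta\frac{\partial^2F}{\partial m^2}(m)(\xi,\eta)\,m(d\eta)\,m(d\xi)=\sum_{j,k=1}^K\operatorname{tr}\big(D_{x^j}D_{x^k}\Phi(x)\big).$$ 3. Let $a(\xi)=\sigma(\xi)\sigma(\xi)^*$ with $\sigma:\mathbb R^n\to\mathbb R^{n\times n}$ continuous. For every $R$ there is a constant $C$ (depending only on $F,\sigma,R$) such that for all $K\ge1$ and all $x^1,\dots,x^K$ with $|x^j|\le R$, $$\Big|\int_{\mathbb R^n}\operatorname{tr}\Big(a(\xi)D_\xi^2\frac{\partial F}{\partial m}(m)(\xi)\Big)m(d\xi)-\sum_{j=1}^K\operatorname{tr}\big(a(x^j)D_{x^j}^2\Phi(x)\big)\Big|\le\frac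 CK.$$ If moreover $\sigma$ is bounded and $D_\xi D_\eta\frac{\partial^2F}{\partial m^2}(m)(\xi,\eta)$ is bounded uniformly in $\xi,\eta$ and in boundedly supported $m$, then one constant $C$ (depending only on $F,\sigma$) works for all $K\ge1$ and all $x\in(\mathbb R^n)^K$. -/

import Mathlib

open MeasureTheory

noncomputable section

namespace MeanField

/-- The state space `ℝⁿ`. -/
abbrev State (n : ℕ) := EuclideanSpace ℝ (Fin n)

/-- The Hilbert space `L²(ℝⁿ)`. -/
abbrev L2 (n : ℕ) := Lp ℝ 2 (volume : Measure (State n))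

/-- The function `m` vanishes almost everywhere outside some ball. -/
def BoundedSupport {n : ℕ} (m : L2 n) : Prop :=
  ∃ R : ℝ, ∀ᵐ ξ ∂(volume : Measure (State n)), R < ‖ξ‖ → m ξ = 0

/-- `g = ∂F/∂m (m)` is the Gâteaux derivative of `F` at `m`:
`d/dθ F(m + θ m̃) |_{θ = 0} = ∫ g(ξ) m̃(ξ) dξ`.
The directions `m̃` are the boundedly supported elements of `L²(ℝⁿ)` and, accordingly, `g` is only
required to be locally square integrable; this admits functionals such as
`F(m) = ∫∫ Γ(u,v) m(u) m(v) du dv` with a kernel `Γ` that is continuous but unbounded. -/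
def HasGateauxDeriv {n : ℕ} (F : L2 n → ℝ) (m : L2 n) (g : State n → ℝ) : Prop :=
  (∀ R : ℝ, MemLp g 2 (volume.restrict (Metric.closedBall (0 : State n) R))) ∧
    ∀ m' : L2 n, BoundedSupport m' →
      HasDerivAt (fun θ : ℝ => F (m + θ • m')) (∫ ξ, g ξ * m' ξ) 0

/-- The probability measure `μ` has the density `m ∈ L²(ℝⁿ)`. -/
def IsDensity {n : ℕ} (m : L2 n) (μ : ProbabilityMeasure (State n)) : Prop :=
  (∀ᵐ ξ ∂(volume : Measure (State n)), 0 ≤ m ξ) ∧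
    (μ : Measure (State n)) = volume.withDensity (fun ξ => ENNReal.ofReal (m ξ))

/-- The probability measures carried by the closed ball of radius `R` about the origin. -/
def carriedBy (n : ℕ) (R : ℝ) : Set (ProbabilityMeasure (State n)) :=
  {μ | (μ : Measure (State n)) (Metric.closedBall (0 : State n) R)ᶜ = 0}

/-- The mixed derivative `D_ξ D_η V (ξ, η)`, as a linear operator on `ℝⁿ`. -/
def mixedDeriv {n : ℕ} (V : State n → State n → ℝ) (ξ η : State n) : State n →L[ℝ] State n :=
  fderiv ℝ (fun ξ' => gradient (fun η' => V ξ' η') η) ξ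

/-- The Hessian `D² f (ξ)`, as a linear operator on `ℝⁿ`. -/
def hessian {n : ℕ} (f : State n → ℝ) (ξ : State n) : State n →L[ℝ] State n :=
  fderiv ℝ (gradient f) ξ

/-- The trace of an operator on `ℝⁿ`. -/
def tr {n : ℕ} (A : State n →L[ℝ] State n) : ℝ :=
  LinearMap.trace ℝ (State n) (A : State n →ₗ[ℝ] State n)

/-- The functional `F` on `L²(ℝⁿ)` is twice continuously differentiable with respect to `m`, with
`∂F/∂m = dF` and `∂²F/∂m² = d2F`, and `F`, `∂F/∂m`, `∂²F/∂m²` extend from (boundedly supported)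
densities to probability measures as `Fbar`, `U`, `V`. The extensions are continuous for weak
convergence of measures carried by a common ball, together with the space derivatives
`D_ξ U`, `D_ξ² U`, `D_η V`, `D_ξ D_η V`. -/
structure IsSmoothFunctional {n : ℕ}
    (F : L2 n → ℝ) (dF : L2 n → State n → ℝ) (d2F : L2 n → State n → State n → ℝ)
    (Fbar : ProbabilityMeasure (State n) → ℝ)
    (U : ProbabilityMeasure (State n) → State n → ℝ)
    (V : ProbabilityMeasure (State n) → State n → State n → ℝ) : Prop where
  gateaux : ∀ m, BoundedSupport m → HasGateauxDeriv F m (dF m)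
  gateaux₂ : ∀ m, BoundedSupport m → ∀ ξ, HasGateauxDeriv (fun m' => dF m' ξ) m (d2F m ξ)
  extend : ∀ m μ, BoundedSupport m → IsDensity m μ → Fbar μ = F m
  extend₁ : ∀ m μ, BoundedSupport m → IsDensity m μ → ∀ ξ, U μ ξ = dF m ξ
  extend₂ : ∀ m μ, BoundedSupport m → IsDensity m μ → ∀ ξ η, V μ ξ η = d2F m ξ η
  continuousOn_Fbar : ∀ R, ContinuousOn Fbar (carriedBy n R)
  continuousOn_U : ∀ R, ContinuousOn
    (fun p : ProbabilityMeasure (State n) × State n => U p.1 p.2)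
    (carriedBy n R ×ˢ Set.univ)
  continuousOn_V : ∀ R, ContinuousOn
    (fun p : ProbabilityMeasure (State n) × State n × State n => V p.1 p.2.1 p.2.2)
    (carriedBy n R ×ˢ Set.univ)
  contDiff_U : ∀ R, ∀ μ ∈ carriedBy n R, ContDiff ℝ 2 (U μ)
  continuousOn_gradient_U : ∀ R, ContinuousOn
    (fun p : ProbabilityMeasure (State n) × State n => gradient (U p.1) p.2)
    (carriedBy n R ×ˢ Set.univ)
  continuousOn_hessian_U : ∀ R, ContinuousOn
    (fun p : ProbabilityMeasure (State n) × State n => hessian (U p.1) p.2)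
    (carriedBy n R ×ˢ Set.univ)
  differentiable_V : ∀ R, ∀ μ ∈ carriedBy n R, ∀ ξ, Differentiable ℝ (fun η => V μ ξ η)
  differentiable_gradient_V : ∀ R, ∀ μ ∈ carriedBy n R, ∀ η,
    Differentiable ℝ (fun ξ => gradient (fun η' => V μ ξ η') η)
  continuousOn_gradient_V : ∀ R, ContinuousOn
    (fun p : ProbabilityMeasure (State n) × State n × State n =>
      gradient (fun η => V p.1 p.2.1 η) p.2.2)
    (carriedBy n R ×ˢ Set.univ)
  continuousOn_mixedDeriv_V : ∀ R, ContinuousOn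
    (fun p : ProbabilityMeasure (State n) × State n × State n =>
      mixedDeriv (V p.1) p.2.1 p.2.2)
    (carriedBy n R ×ˢ Set.univ)

/-- The empirical measure `(1/K) ∑ⱼ δ_{xʲ}`. -/
def empirical {n K : ℕ} [NeZero K] (x : Fin K → State n) : ProbabilityMeasure (State n) :=
  ⟨(K : ENNReal)⁻¹ • ∑ j, Measure.dirac (x j), ⟨by
    simp only [Measure.smul_apply, Measure.finsetSum_apply, measure_univ, Finset.sum_const,
      Finset.card_univ, Fintype.card_fin, nsmul_eq_mul, mul_one, smul_eq_mul]
    exact ENNReal.inv_mul_cancel (by exact_mod_cast NeZero.ne K) (ENNReal.natCast_ne_top K)⟩⟩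

/-- `Φ(x¹, …, xᴷ) = F((1/K) ∑ⱼ δ_{xʲ})`. -/
def restrictEmpirical {n : ℕ} (Fbar : ProbabilityMeasure (State n) → ℝ) (K : ℕ) [NeZero K]
    (x : Fin K → State n) : ℝ :=
  Fbar (empirical x)

/-- The partial gradient `D_{xʲ} Φ(x)`. -/
def partialGrad {n K : ℕ} (Φ : (Fin K → State n) → ℝ) (j : Fin K) (x : Fin K → State n) :
    State n :=
  gradient (fun y => Φ (Function.update x j y)) (x j)

/-- The second partial derivative `D_{xʲ} D_{xᵏ} Φ(x)`, as a linear operator on `ℝⁿ`. -/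
def partialHess {n K : ℕ} (Φ : (Fin K → State n) → ℝ) (j k : Fin K) (x : Fin K → State n) :
    State n →L[ℝ] State n :=
  fderiv ℝ (fun y => partialGrad Φ k (Function.update x j y)) (x j)

/-- `a(ξ) = σ(ξ) σ(ξ)*`. -/
def diffusion {n : ℕ} (σ : State n → (State n →L[ℝ] State n)) (ξ : State n) :
    State n →L[ℝ] State n :=
  σ ξ ∘L ContinuousLinearMap.adjoint (σ ξ)

/-- `∫ tr(a(ξ) D_ξ² U(μ, ξ)) dμ(ξ) - ∑ⱼ tr(a(xʲ) D²_{xʲ} Φ(x))`, for `μ = (1/K) ∑ⱼ δ_{xʲ}`. -/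
def weightedDefect {n : ℕ} (Fbar : ProbabilityMeasure (State n) → ℝ)
    (U : ProbabilityMeasure (State n) → State n → ℝ)
    (σ : State n → (State n →L[ℝ] State n)) (K : ℕ) [NeZero K] (x : Fin K → State n) : ℝ :=
  (∫ ξ, tr (diffusion σ ξ ∘L hessian (U (empirical x)) ξ) ∂(empirical x : Measure (State n))) -
    ∑ j, tr (diffusion σ (x j) ∘L partialHess (restrictEmpirical Fbar K) j j x)

end MeanField

end

noncomputable section

namespace MeanField

open Filter Topology Asymptotics

/-! Everything follows from two formulas for the empirical measure `m` of `x`: `D_{xʲ} Φ = K⁻¹ D_ξ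
U(m)(xʲ)`, and `D_{xʲ} D_{xᵏ} Φ = K⁻² (D_ξ D_η V(m)(xᵏ, xʲ))*`, plus `K⁻¹ D_ξ² U(m)(xʲ)` when `j =
k`. Integration against `m` is an average over the atoms, so the first two conclusions are sums of
these formulas. In the third the Hessians of `U` cancel, and what remains is `K` bounded terms with
the factor `K⁻²`.

The Gâteaux derivative says nothing directly about point masses. For the first formula
(`hasGradientAt_update_empirical`) each atom is therefore spread over a small ball, which gives an
`L²` density. Along the segment between the densities before and after one atom moves, the
derivative of the functional is `K⁻¹` times an average of increments of `U`. Continuity of `D_ξ U`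
bounds its error uniformly along the segment and in the radius, so the radius can go to zero.

For the second formula (`partialHess_restrictEmpirical`), `D_ξ U(m)(xᵏ)` depends on `xʲ` through `m`
and, if `j = k`, through the point. The same lemma applied to `m ↦ ∂F/∂m(m)(ξ)` differentiates `U`
in the atom; the `ξ`-gradient of the result is known, but what is needed is the atom-derivative of
the `ξ`-gradient. `isLittleO_gradient_sub` exchanges the two, at the price of an adjoint. -/

/-! ### Exchange of mixed partial gradients -/

lemma norm_gradient_sub_le {E : Type*} [NormedAddCommGroup E] [InnerProductSpace ℝ E]
    [CompleteSpace E] {f : E → ℝ} {x L : E} {C : ℝ} (hC : 0 ≤ C)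
    (hf : DifferentiableAt ℝ f x)
    (h : ∀ᶠ y in 𝓝 x, |f y - f x - inner ℝ L (y - x)| ≤ C * ‖y - x‖) :
    ‖gradient f x - L‖ ≤ C := by
  have hg : HasFDerivAt (fun y => f y - inner ℝ L (y - x))
      (InnerProductSpace.toDual ℝ E (gradient f x) - InnerProductSpace.toDual ℝ E L) x := by
    refine HasFDerivAt.sub hf.hasGradientAt.hasFDerivAt ?_
    exact ((InnerProductSpace.toDual ℝ E L).hasFDerivAt (x := x - x)).comp
      (f := fun y => y - x) x ((hasFDerivAt_id x).sub_const x)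
  have := hg.le_of_lip' hC (by
    filter_upwards [h] with y hy
    simpa [sub_right_comm] using hy)
  rwa [← map_sub, LinearIsometryEquiv.norm_map] at this

/-- If the partial gradient `q` of `u` in the first variable has a derivative `D` in the second
variable, continuous at `(y₀, ξ₀)`, then the partial gradient of `u` in the second variable is
differentiable in the first variable with derivative `D*`, uniformly near `ξ₀`. -/
lemma isLittleO_gradient_sub {E : Type*} [NormedAddCommGroup E] [InnerProductSpace ℝ E]
    [CompleteSpace E] {u : E → E → ℝ} {q : E → E → E} {D : E → E → E →L[ℝ] E} {y₀ ξ₀ : E}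
    (hq : ∀ y ξ, HasGradientAt (fun y => u y ξ) (q y ξ) y)
    (hD : ∀ y ξ, HasFDerivAt (q y) (D y ξ) ξ)
    (hc : ContinuousAt (fun p : E × E => D p.1 p.2) (y₀, ξ₀))
    (hu : ∀ y, Differentiable ℝ (u y)) :
    (fun p : E × E => gradient (u p.1) p.2 - gradient (u y₀) p.2 -
      ContinuousLinearMap.adjoint (D y₀ ξ₀) (p.1 - y₀)) =o[𝓝 (y₀, ξ₀)] fun p => p.1 - y₀ := by
  rw [isLittleO_iff]
  intro δ hδ
  obtain ⟨r, hr, hball⟩ := Metric.eventually_nhds_iff_ball.1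
    (Metric.continuousAt_iff'.1 hc δ hδ)
  rw [← ball_prod_same] at hball
  have hmem : ∀ᶠ p : E × E in 𝓝 (y₀, ξ₀), p ∈ Metric.ball y₀ r ×ˢ Metric.ball ξ₀ r := by
    rw [ball_prod_same]; exact Metric.ball_mem_nhds _ hr
  filter_upwards [hmem] with ⟨y, ξ⟩ ⟨hy, hξ⟩
  -- The argument estimates the second difference of `u` over `{y₀, y} × {ξ, ξ'}`. This bound
  -- controls its gradient in the first variable; a mean value inequality in that variable and then
  -- `ξ' → ξ` finish.
  have hq' : ∀ y ∈ Metric.ball y₀ r, ∀ ξ ∈ Metric.ball ξ₀ r, ∀ ξ' ∈ Metric.ball ξ₀ r,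
      ‖q y ξ' - q y ξ - D y₀ ξ₀ (ξ' - ξ)‖ ≤ δ * ‖ξ' - ξ‖ := by
    intro y hy ξ hξ ξ' hξ'
    refine (convex_ball ξ₀ r).norm_image_sub_le_of_norm_hasFDerivWithin_le'
      (fun z _ => (hD y z).hasFDerivWithinAt) (fun z hz => ?_) hξ hξ'
    have := hball (y, z) ⟨hy, hz⟩
    rw [dist_eq_norm] at this
    exact this.le
  have hdiff : Differentiable ℝ (fun z => u y z - u y₀ z) := (hu y).sub (hu y₀)
  have key : ‖gradient (fun z => u y z - u y₀ z) ξ -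
      ContinuousLinearMap.adjoint (D y₀ ξ₀) (y - y₀)‖ ≤ δ * ‖y - y₀‖ := by
    refine norm_gradient_sub_le (by positivity) hdiff.differentiableAt ?_
    filter_upwards [Metric.isOpen_ball.mem_nhds hξ] with ξ' hξ'
    have := (convex_ball y₀ r).norm_image_sub_le_of_norm_hasFDerivWithin_le'
      (f := fun y => u y ξ' - u y ξ)
      (φ := InnerProductSpace.toDual ℝ E (D y₀ ξ₀ (ξ' - ξ))) (C := δ * ‖ξ' - ξ‖)
      (fun z _ => ((hq z ξ').hasFDerivAt.sub (hq z ξ).hasFDerivAt).hasFDerivWithinAt)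
      (fun z hz => by
        rw [← map_sub, ← map_sub, LinearIsometryEquiv.norm_map]
        exact hq' z hz ξ hξ ξ' hξ') (Metric.mem_ball_self hr) hy
    rw [ContinuousLinearMap.adjoint_inner_left, real_inner_comm]
    rw [InnerProductSpace.toDual_apply_apply, Real.norm_eq_abs] at this
    calc _ = |u y ξ' - u y ξ - (u y₀ ξ' - u y₀ ξ) - inner ℝ (D y₀ ξ₀ (ξ' - ξ)) (y - y₀)| := by
          congr 1; ring
      _ ≤ _ := this.trans_eq (by ring)
  have hgrad : gradient (fun z => u y z - u y₀ z) ξ = gradient (u y) ξ - gradient (u y₀) ξ := by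
    refine HasGradientAt.gradient ?_
    rw [hasGradientAt_iff_hasFDerivAt, map_sub]
    exact (hu y ξ).hasGradientAt.hasFDerivAt.sub (hu y₀ ξ).hasGradientAt.hasFDerivAt
  rwa [hgrad] at key

/-! ### Square integrable densities and bounded support -/

section

variable {n : ℕ}

/-- `IsDensity` for measures that need not be normalized. -/
def HasL2Density (m : L2 n) (μ : Measure (State n)) : Prop :=
  (∀ᵐ ξ ∂(volume : Measure (State n)), 0 ≤ m ξ) ∧
    μ = volume.withDensity (fun ξ => ENNReal.ofReal (m ξ))

lemma HasL2Density.zero : HasL2Density (0 : L2 n) 0 := by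
  refine ⟨.of_forall fun ξ => by simp, ?_⟩
  rw [withDensity_congr_ae (g := 0), withDensity_zero]
  exact .of_forall fun ξ => by simp

lemma HasL2Density.add {m₁ m₂ : L2 n} {μ₁ μ₂ : Measure (State n)} (h₁ : HasL2Density m₁ μ₁)
    (h₂ : HasL2Density m₂ μ₂) : HasL2Density (m₁ + m₂) (μ₁ + μ₂) := by
  have h := Lp.coeFn_add m₁ m₂
  refine ⟨by filter_upwards [h, h₁.1, h₂.1] with ξ hξ h1 h2; rw [hξ]; exact add_nonneg h1 h2, ?_⟩
  rw [h₁.2, h₂.2, ← withDensity_add_left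
    (Lp.stronglyMeasurable m₁).measurable.ennreal_ofReal]
  refine withDensity_congr_ae ?_
  filter_upwards [h, h₁.1, h₂.1] with ξ hξ h1 h2
  rw [hξ, Pi.add_apply, Pi.add_apply, ENNReal.ofReal_add h1 h2]

lemma HasL2Density.smul {m : L2 n} {μ : Measure (State n)} (h : HasL2Density m μ) {c : ℝ}
    (hc : 0 ≤ c) : HasL2Density (c • m) (ENNReal.ofReal c • μ) := by
  have h' := Lp.coeFn_smul c m
  refine ⟨by filter_upwards [h', h.1] with ξ hξ h1; rw [hξ]; exact mul_nonneg hc h1, ?_⟩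
  rw [h.2, ← withDensity_smul _ (Lp.stronglyMeasurable m).measurable.ennreal_ofReal]
  refine withDensity_congr_ae ?_
  filter_upwards [h'] with ξ hξ
  rw [hξ, Pi.smul_apply, Pi.smul_apply, smul_eq_mul, smul_eq_mul, ENNReal.ofReal_mul hc]

lemma HasL2Density.sum {ι : Type*} (s : Finset ι) {m : ι → L2 n} {μ : ι → Measure (State n)}
    (h : ∀ i, HasL2Density (m i) (μ i)) : HasL2Density (∑ i ∈ s, m i) (∑ i ∈ s, μ i) := by
  classical
  induction s using Finset.induction_on with
  | empty => simpa using HasL2Density.zero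
  | insert a s ha ih => rw [Finset.sum_insert ha, Finset.sum_insert ha]; exact (h a).add ih

lemma HasL2Density.integral_eq {m : L2 n} {μ : Measure (State n)} (h : HasL2Density m μ)
    (g : State n → ℝ) : ∫ ξ, g ξ ∂μ = ∫ ξ, g ξ * m ξ := by
  rw [h.2, integral_withDensity_eq_integral_toReal_smul₀
    (Lp.stronglyMeasurable m).measurable.ennreal_ofReal.aemeasurable (by simp)]
  refine integral_congr_ae ?_
  filter_upwards [h.1] with ξ hξ
  rw [ENNReal.toReal_ofReal hξ, smul_eq_mul, mul_comm]

lemma HasL2Density.integrable_mul {m : L2 n} {μ : Measure (State n)} (h : HasL2Density m μ)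
    {g : State n → ℝ} (hg : Integrable g μ) : Integrable (fun ξ => g ξ * m ξ) := by
  rw [h.2, integrable_withDensity_iff_integrable_smul₀'
    (Lp.stronglyMeasurable m).measurable.ennreal_ofReal.aemeasurable (by simp)] at hg
  refine hg.congr ?_
  filter_upwards [h.1] with ξ hξ
  rw [ENNReal.toReal_ofReal hξ, smul_eq_mul, mul_comm]

lemma BoundedSupport.zero : BoundedSupport (0 : L2 n) :=
  ⟨0, .of_forall fun ξ _ => by simp⟩

lemma BoundedSupport.add {m₁ m₂ : L2 n} (h₁ : BoundedSupport m₁) (h₂ : BoundedSupport m₂) :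
    BoundedSupport (m₁ + m₂) := by
  obtain ⟨R₁, h₁⟩ := h₁
  obtain ⟨R₂, h₂⟩ := h₂
  refine ⟨max R₁ R₂, ?_⟩
  filter_upwards [Lp.coeFn_add m₁ m₂, h₁, h₂] with ξ hξ h1 h2 hR
  rw [hξ, Pi.add_apply, h1 ((le_max_left _ _).trans_lt hR), h2 ((le_max_right _ _).trans_lt hR),
    add_zero]

lemma BoundedSupport.smul {m : L2 n} (h : BoundedSupport m) (c : ℝ) : BoundedSupport (c • m) := by
  obtain ⟨R, h⟩ := h
  refine ⟨R, ?_⟩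
  filter_upwards [Lp.coeFn_smul c m, h] with ξ hξ h1 hR
  rw [hξ, Pi.smul_apply, h1 hR, smul_zero]

lemma BoundedSupport.sub {m₁ m₂ : L2 n} (h₁ : BoundedSupport m₁) (h₂ : BoundedSupport m₂) :
    BoundedSupport (m₁ - m₂) := by
  have := h₁.add (h₂.smul (-1))
  rwa [neg_one_smul, ← sub_eq_add_neg] at this

lemma BoundedSupport.sum {ι : Type*} (s : Finset ι) {m : ι → L2 n}
    (h : ∀ i, BoundedSupport (m i)) : BoundedSupport (∑ i ∈ s, m i) := by
  classical
  induction s using Finset.induction_on with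
  | empty => simpa using BoundedSupport.zero
  | insert a s ha ih => rw [Finset.sum_insert ha]; exact (h a).add ih

/-! ### Mollified empirical measures -/

/-- The uniform distribution on the closed ball of radius `1 / (k + 1)` about `x`. -/
def ballAverage (k : ℕ) (x : State n) : Measure (State n) :=
  ProbabilityTheory.cond volume (Metric.closedBall x (1 / ((k : ℝ) + 1)))

lemma measure_closedBall_ne_zero (k : ℕ) (x : State n) :
    volume (Metric.closedBall x (1 / ((k : ℝ) + 1))) ≠ 0 :=
  (Metric.measure_closedBall_pos _ _ Nat.one_div_pos_of_nat).ne'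

instance (k : ℕ) (x : State n) : IsProbabilityMeasure (ballAverage k x) :=
  ProbabilityTheory.cond_isProbabilityMeasure_of_finite (measure_closedBall_ne_zero k x)
    measure_closedBall_lt_top.ne

/-- The density of the uniform distribution on a ball. -/
def ballDensity (k : ℕ) (x : State n) : L2 n :=
  indicatorConstLp 2 (Metric.isClosed_closedBall (x := x) (ε := 1 / ((k : ℝ) + 1))).measurableSet
    measure_closedBall_lt_top.ne (volume.real (Metric.closedBall x (1 / ((k : ℝ) + 1))))⁻¹

lemma hasL2Density_ballDensity (k : ℕ) (x : State n) :
    HasL2Density (ballDensity k x) (ballAverage k x) := by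
  have h : ballDensity k x =ᵐ[volume] _ := indicatorConstLp_coeFn
  refine ⟨?_, ?_⟩
  · filter_upwards [h] with ξ hξ
    rw [hξ]
    exact Set.indicator_nonneg (fun _ _ => by positivity) _
  · rw [ballAverage, ProbabilityTheory.cond, ← withDensity_const,
      ← withDensity_indicator Metric.isClosed_closedBall.measurableSet]
    refine withDensity_congr_ae ?_
    filter_upwards [h] with ξ hξ
    rw [hξ]
    by_cases hx : ξ ∈ Metric.closedBall x (1 / ((k : ℝ) + 1))
    · rw [Set.indicator_of_mem hx, Set.indicator_of_mem hx, ENNReal.ofReal_inv_of_pos,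
        ofReal_measureReal measure_closedBall_lt_top.ne]
      exact ENNReal.toReal_pos (measure_closedBall_ne_zero k x) measure_closedBall_lt_top.ne
    · rw [Set.indicator_of_notMem hx, Set.indicator_of_notMem hx, ENNReal.ofReal_zero]

lemma boundedSupport_ballDensity (k : ℕ) (x : State n) : BoundedSupport (ballDensity k x) := by
  have h : ballDensity k x =ᵐ[volume] _ := indicatorConstLp_coeFn
  refine ⟨‖x‖ + 1 / ((k : ℝ) + 1), ?_⟩
  filter_upwards [h] with ξ hξ hR
  rw [hξ, Set.indicator_of_notMem]
  intro hx
  have := norm_le_norm_add_norm_sub' ξ x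
  rw [mem_closedBall_iff_norm] at hx
  linarith

lemma ae_ballAverage (k : ℕ) (x : State n) :
    ∀ᵐ ξ ∂(ballAverage k x), ξ ∈ Metric.closedBall x (1 / ((k : ℝ) + 1)) :=
  ProbabilityTheory.ae_cond_mem Metric.isClosed_closedBall.measurableSet

/-- By translation invariance of Lebesgue measure. Moving an atom thus becomes a translation inside
an integral against a fixed measure. -/
lemma map_add_ballAverage (k : ℕ) (x h : State n) :
    (ballAverage k x).map (· + h) = ballAverage k (x + h) := by
  rw [ballAverage, ballAverage, ProbabilityTheory.cond, ProbabilityTheory.cond, Measure.map_smul,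
    Measure.addHaar_closedBall_center volume x, Measure.addHaar_closedBall_center volume (x + h)]
  congr 1
  have hpre : (· + h) ⁻¹' Metric.closedBall (x + h) (1 / ((k : ℝ) + 1)) =
      Metric.closedBall x (1 / ((k : ℝ) + 1)) := by
    ext; simp
  rw [← hpre, ← Measure.restrict_map (measurable_add_const h)
    Metric.isClosed_closedBall.measurableSet, map_add_right_eq_self]

lemma integrable_of_ae_mem_closedBall {μ : Measure (State n)} [IsFiniteMeasure μ]
    {g : State n → ℝ} (hg : Continuous g) {x : State n} {R : ℝ}
    (h : ∀ᵐ ξ ∂μ, ξ ∈ Metric.closedBall x R) : Integrable g μ := by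
  rw [← Measure.restrict_eq_self_of_ae_mem h]
  exact hg.continuousOn.integrableOn_compact (isCompact_closedBall x R)

lemma tendsto_integral_ballAverage {α : Type*} {l : Filter α} {k : α → ℕ} {y : α → State n}
    {x : State n} (hk : Tendsto k l atTop) (hy : Tendsto y l (𝓝 x)) {f : State n → ℝ}
    (hf : Continuous f) : Tendsto (fun a => ∫ ξ, f ξ ∂(ballAverage (k a) (y a))) l (𝓝 (f x)) := by
  rw [Metric.tendsto_nhds]
  intro δ hδ
  obtain ⟨r, hr, hball⟩ := Metric.continuousAt_iff.1 hf.continuousAt (δ / 2) (half_pos hδ)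
  have h1 := (tendsto_one_div_add_atTop_nhds_zero_nat (𝕜 := ℝ)).comp hk
  filter_upwards [h1.eventually (gt_mem_nhds (half_pos hr)),
    Metric.tendsto_nhds.1 hy (r / 2) (half_pos hr)] with a ha hya
  simp only [Function.comp_apply] at ha
  have hint : Integrable f (ballAverage (k a) (y a)) :=
    integrable_of_ae_mem_closedBall hf (ae_ballAverage _ _)
  have : ‖∫ ξ, (f ξ - f x) ∂(ballAverage (k a) (y a))‖ ≤ δ / 2 := by
    have := norm_integral_le_of_norm_le_const (μ := ballAverage (k a) (y a))
      (f := fun ξ => f ξ - f x) (C := δ / 2) (by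
        filter_upwards [ae_ballAverage (k a) (y a)] with ξ hξ
        refine (hball ?_).le
        have := dist_triangle ξ (y a) x
        rw [Metric.mem_closedBall] at hξ
        linarith)
    simpa using this
  rw [integral_sub hint (integrable_const _)] at this
  simp only [integral_const, probReal_univ, one_smul] at this
  rw [Real.dist_eq]
  rw [Real.norm_eq_abs] at this
  linarith

variable {K : ℕ}

/-- The density of `mollified k x`. -/
def mollifiedDensity (k : ℕ) (x : Fin K → State n) : L2 n :=
  (K : ℝ)⁻¹ • ∑ j, ballDensity k (x j)

lemma boundedSupport_mollifiedDensity (k : ℕ) (x : Fin K → State n) :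
    BoundedSupport (mollifiedDensity k x) :=
  (BoundedSupport.sum _ fun j => boundedSupport_ballDensity k (x j)).smul _

variable [NeZero K]

/-- The empirical measure with each atom spread over a ball of radius `1 / (k + 1)`. -/
def mollified (k : ℕ) (x : Fin K → State n) : ProbabilityMeasure (State n) :=
  ⟨(K : ENNReal)⁻¹ • ∑ j, ballAverage k (x j), ⟨by
    simp only [Measure.smul_apply, Measure.finsetSum_apply, measure_univ, Finset.sum_const,
      Finset.card_univ, Fintype.card_fin, nsmul_eq_mul, mul_one, smul_eq_mul]
    exact ENNReal.inv_mul_cancel (by exact_mod_cast NeZero.ne K) (ENNReal.natCast_ne_top K)⟩⟩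

lemma hasL2Density_mollifiedDensity (k : ℕ) (x : Fin K → State n) :
    HasL2Density (mollifiedDensity k x) (mollified k x : Measure (State n)) := by
  have h := (HasL2Density.sum Finset.univ
    (fun j => hasL2Density_ballDensity k (x j))).smul (c := (K : ℝ)⁻¹) (by positivity)
  rwa [ENNReal.ofReal_inv_of_pos (by exact_mod_cast NeZero.pos K), ENNReal.ofReal_natCast] at h

lemma integral_mollified (k : ℕ) (x : Fin K → State n) {f : State n → ℝ} (hf : Continuous f) :
    ∫ ξ, f ξ ∂(mollified k x : Measure (State n)) =
      (K : ℝ)⁻¹ * ∑ j, ∫ ξ, f ξ ∂(ballAverage k (x j)) := by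
  have : (mollified k x : Measure (State n)) = (K : ENNReal)⁻¹ • ∑ j, ballAverage k (x j) := rfl
  rw [this, integral_smul_measure, integral_finsetSum_measure]
  · simp
  · exact fun j _ => integrable_of_ae_mem_closedBall hf (ae_ballAverage _ _)

lemma integral_empirical {E : Type*} [NormedAddCommGroup E] [NormedSpace ℝ E]
    [CompleteSpace E] (x : Fin K → State n) (f : State n → E) :
    ∫ ξ, f ξ ∂(empirical x : Measure (State n)) = (K : ℝ)⁻¹ • ∑ j, f (x j) := by
  have : (empirical x : Measure (State n)) = (K : ENNReal)⁻¹ • ∑ j, Measure.dirac (x j) := rfl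
  rw [this, integral_smul_measure, integral_finsetSum_measure]
  · simp
  · exact fun j _ => integrable_dirac (by simp)

lemma empirical_mem_carriedBy {x : Fin K → State n} {R : ℝ} (h : ∀ j, ‖x j‖ ≤ R) :
    empirical x ∈ carriedBy n R := by
  have : (empirical x : Measure (State n)) = (K : ENNReal)⁻¹ • ∑ j, Measure.dirac (x j) := rfl
  simp [carriedBy, this, h]

lemma mollified_mem_carriedBy {k : ℕ} {x : Fin K → State n} {R : ℝ} (h : ∀ j, ‖x j‖ + 1 ≤ R) :
    mollified k x ∈ carriedBy n R := by
  have : (mollified k x : Measure (State n)) = (K : ENNReal)⁻¹ • ∑ j, ballAverage k (x j) := rfl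
  simp only [carriedBy, Set.mem_ofPred_eq, this, Measure.smul_apply, Measure.finsetSum_apply,
    smul_eq_mul]
  rw [Finset.sum_eq_zero, mul_zero]
  intro j _
  refine (measure_eq_zero_iff_ae_notMem.2 ?_)
  filter_upwards [ae_ballAverage k (x j)] with ξ hξ
  rw [mem_closedBall_iff_norm] at hξ
  have h1 := norm_le_norm_add_norm_sub' ξ (x j)
  have h2 : 1 / ((k : ℝ) + 1) ≤ 1 := by
    rw [div_le_one (by positivity)]; linarith [(Nat.cast_nonneg k : (0 : ℝ) ≤ k)]
  simpa using by linarith [h j]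

/-! ### Segments of measures and weak limits -/

/-- The convex combination `(1 - t) μ + t ν`. -/
def convexComb (t : unitInterval) (μ ν : ProbabilityMeasure (State n)) :
    ProbabilityMeasure (State n) :=
  ⟨ENNReal.ofReal (1 - t) • (μ : Measure (State n)) + ENNReal.ofReal t • (ν : Measure (State n)),
    ⟨by
      simp only [Measure.add_apply, Measure.smul_apply, measure_univ, smul_eq_mul, mul_one]
      rw [← ENNReal.ofReal_add (by linarith [t.2.2]) t.2.1]
      simp⟩⟩

lemma isDensity_convexComb {m₀ m₁ : L2 n} {μ₀ μ₁ : ProbabilityMeasure (State n)}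
    (h₀ : HasL2Density m₀ (μ₀ : Measure (State n)))
    (h₁ : HasL2Density m₁ (μ₁ : Measure (State n))) (t : unitInterval) :
    IsDensity (m₀ + (t : ℝ) • (m₁ - m₀)) (convexComb t μ₀ μ₁) := by
  have := (h₀.smul (c := 1 - t) (by linarith [t.2.2])).add (h₁.smul t.2.1)
  have hm : m₀ + (t : ℝ) • (m₁ - m₀) = (1 - (t : ℝ)) • m₀ + (t : ℝ) • m₁ := by module
  rw [hm]
  exact this

lemma convexComb_mem_carriedBy {μ ν : ProbabilityMeasure (State n)} {R : ℝ}
    (hμ : μ ∈ carriedBy n R) (hν : ν ∈ carriedBy n R) (t : unitInterval) :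
    convexComb t μ ν ∈ carriedBy n R := by
  have : (convexComb t μ ν : Measure (State n)) =
    ENNReal.ofReal (1 - t) • (μ : Measure (State n)) + ENNReal.ofReal t • (ν : Measure (State n)) :=
    rfl
  simp only [carriedBy, Set.mem_ofPred_eq] at hμ hν ⊢
  simp [this, hμ, hν]

lemma integral_convexComb (t : unitInterval) (μ ν : ProbabilityMeasure (State n))
    {f : State n → ℝ} (hμ : Integrable f (μ : Measure (State n)))
    (hν : Integrable f (ν : Measure (State n))) :
    ∫ ξ, f ξ ∂(convexComb t μ ν : Measure (State n)) =
      ∫ ξ, f ξ ∂(μ : Measure (State n)) +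
        t * (∫ ξ, f ξ ∂(ν : Measure (State n)) - ∫ ξ, f ξ ∂(μ : Measure (State n))) := by
  have : (convexComb t μ ν : Measure (State n)) =
    ENNReal.ofReal (1 - t) • (μ : Measure (State n)) + ENNReal.ofReal t • (ν : Measure (State n)) :=
    rfl
  rw [this, integral_add_measure (hμ.smul_measure ENNReal.ofReal_ne_top)
    (hν.smul_measure ENNReal.ofReal_ne_top), integral_smul_measure, integral_smul_measure,
    ENNReal.toReal_ofReal (by linarith [t.2.2]), ENNReal.toReal_ofReal t.2.1, smul_eq_mul,
    smul_eq_mul]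
  ring

lemma tendsto_mollified {α : Type*} {l : Filter α} {k : α → ℕ} {y : α → Fin K → State n}
    {x : Fin K → State n} (hk : Tendsto k l atTop) (hy : Tendsto y l (𝓝 x)) :
    Tendsto (fun a => mollified (k a) (y a)) l (𝓝 (empirical x)) := by
  rw [ProbabilityMeasure.tendsto_iff_forall_integral_tendsto]
  intro f
  simp_rw [integral_empirical, integral_mollified _ _ f.continuous, smul_eq_mul]
  exact (tendsto_finsetSum _ fun j _ =>
    tendsto_integral_ballAverage hk (tendsto_pi_nhds.1 hy j) f.continuous).const_mul _

lemma tendsto_empirical {α : Type*} {l : Filter α} {y : α → Fin K → State n}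
    {x : Fin K → State n} (hy : Tendsto y l (𝓝 x)) :
    Tendsto (fun a => empirical (y a)) l (𝓝 (empirical x)) := by
  rw [ProbabilityMeasure.tendsto_iff_forall_integral_tendsto]
  intro f
  simp_rw [integral_empirical]
  exact (tendsto_finsetSum _ fun j _ =>
    (f.continuous.tendsto _).comp (tendsto_pi_nhds.1 hy j)).const_smul _

/-- The weight `t` may vary arbitrarily because both endpoints have the same limit; this is the
source of uniformity along the segment. -/
lemma tendsto_convexComb {α : Type*} {l : Filter α} {t : α → unitInterval}
    {μ ν : α → ProbabilityMeasure (State n)} {κ : ProbabilityMeasure (State n)}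
    (hμ : Tendsto μ l (𝓝 κ)) (hν : Tendsto ν l (𝓝 κ)) :
    Tendsto (fun a => convexComb (t a) (μ a) (ν a)) l (𝓝 κ) := by
  rw [ProbabilityMeasure.tendsto_iff_forall_integral_tendsto] at *
  intro f
  simp_rw [integral_convexComb _ _ _ (f.integrable _) (f.integrable _)]
  have h0 := (hν f).sub (hμ f)
  rw [sub_self] at h0
  have := (hμ f).add (bdd_le_mul_tendsto_zero' 1
    (Eventually.of_forall fun a => by rw [abs_of_nonneg (t a).2.1]; exact (t a).2.2) h0)
  simpa using this

end

/-! ### Differentiation along the motion of one atom -/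

section

variable {n : ℕ}

lemma integrable_of_mem_carriedBy {μ : ProbabilityMeasure (State n)} {R : ℝ}
    (hμ : μ ∈ carriedBy n R) {g : State n → ℝ} (hg : Continuous g) :
    Integrable g (μ : Measure (State n)) :=
  integrable_of_ae_mem_closedBall hg (x := 0) (R := R) hμ

/-- The mean value inequality along a segment of densities. -/
lemma abs_sub_sub_le_of_gateaux {G : L2 n → ℝ} {g : L2 n → State n → ℝ}
    {Gbar : ProbabilityMeasure (State n) → ℝ} {W : ProbabilityMeasure (State n) → State n → ℝ}
    (hG : ∀ m, BoundedSupport m → HasGateauxDeriv G m (g m))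
    (hGbar : ∀ m μ, BoundedSupport m → IsDensity m μ → Gbar μ = G m)
    (hW : ∀ m μ, BoundedSupport m → IsDensity m μ → ∀ ξ, W μ ξ = g m ξ)
    {m₀ m₁ : L2 n} {μ₀ μ₁ : ProbabilityMeasure (State n)}
    (hb₀ : BoundedSupport m₀) (hb₁ : BoundedSupport m₁)
    (h₀ : HasL2Density m₀ (μ₀ : Measure (State n)))
    (h₁ : HasL2Density m₁ (μ₁ : Measure (State n)))
    (hi₀ : ∀ t, Integrable (W (convexComb t μ₀ μ₁)) (μ₀ : Measure (State n)))
    (hi₁ : ∀ t, Integrable (W (convexComb t μ₀ μ₁)) (μ₁ : Measure (State n)))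
    {c C : ℝ}
    (hC : ∀ t, |∫ ξ, W (convexComb t μ₀ μ₁) ξ ∂(μ₁ : Measure (State n)) -
      ∫ ξ, W (convexComb t μ₀ μ₁) ξ ∂(μ₀ : Measure (State n)) - c| ≤ C) :
    |Gbar μ₁ - Gbar μ₀ - c| ≤ C := by
  have hderiv : ∀ t : unitInterval, HasDerivAt (fun s : ℝ => G (m₀ + s • (m₁ - m₀)))
      (∫ ξ, W (convexComb t μ₀ μ₁) ξ ∂(μ₁ : Measure (State n)) -
        ∫ ξ, W (convexComb t μ₀ μ₁) ξ ∂(μ₀ : Measure (State n))) t := by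
    intro t
    have hbt : BoundedSupport (m₀ + (t : ℝ) • (m₁ - m₀)) := hb₀.add ((hb₁.sub hb₀).smul _)
    have h := (hG _ hbt).2 (m₁ - m₀) (hb₁.sub hb₀)
    have hint : ∫ ξ, g (m₀ + (t : ℝ) • (m₁ - m₀)) ξ * (m₁ - m₀ : L2 n) ξ =
        ∫ ξ, W (convexComb t μ₀ μ₁) ξ ∂(μ₁ : Measure (State n)) -
          ∫ ξ, W (convexComb t μ₀ μ₁) ξ ∂(μ₀ : Measure (State n)) := by
      rw [h₁.integral_eq, h₀.integral_eq,
        ← integral_sub (h₁.integrable_mul (hi₁ t)) (h₀.integrable_mul (hi₀ t))]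
      refine integral_congr_ae ?_
      filter_upwards [Lp.coeFn_sub m₁ m₀] with ξ hξ
      rw [hξ, hW _ _ hbt (isDensity_convexComb h₀ h₁ t), Pi.sub_apply, mul_sub]
    rw [hint] at h
    -- Writing `0` as `t - t` turns the derivative at `θ = 0` from the base point at time `t` into
    -- the derivative at time `t` along the segment.
    rw [← sub_self (t : ℝ)] at h
    refine (h.comp_sub_const (t : ℝ) t).congr_of_eventuallyEq (.of_forall fun s => ?_)
    simp only
    congr 1
    module
  -- Mean value inequality on `[0, 1]` after subtracting the linear function `s * c`. The projection
  -- onto `[0, 1]` only makes the derivative a function on all of `ℝ`.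
  have key := norm_image_sub_le_of_norm_deriv_le_segment_01'
    (f := fun s : ℝ => G (m₀ + s • (m₁ - m₀)) - s * c)
    (f' := fun s => (∫ ξ, W (convexComb (Set.projIcc 0 1 zero_le_one s) μ₀ μ₁) ξ
        ∂(μ₁ : Measure (State n)) - ∫ ξ, W (convexComb (Set.projIcc 0 1 zero_le_one s) μ₀ μ₁) ξ
        ∂(μ₀ : Measure (State n))) - c) (C := C)
    (fun s hs => by
      have := (hderiv ⟨s, hs⟩).sub ((hasDerivAt_id s).mul_const c)
      rw [one_mul] at this
      simp only [Set.projIcc_of_mem zero_le_one hs]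
      exact this.hasDerivWithinAt)
    (fun s _ => hC _)
  have e₀ : Gbar μ₀ = G m₀ := hGbar _ _ hb₀ h₀
  have e₁ : Gbar μ₁ = G m₁ := hGbar _ _ hb₁ h₁
  rw [e₀, e₁]
  simpa [Real.norm_eq_abs, sub_right_comm] using key

variable {K : ℕ}

lemma exists_norm_add_le (x : Fin K → State n) (c : ℝ) : ∃ R, ∀ i, ‖x i‖ + c ≤ R :=
  ⟨(∑ i, ‖x i‖) + c, fun i => by
    gcongr
    exact Finset.single_le_sum (f := fun i => ‖x i‖) (fun _ _ => norm_nonneg _)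
      (Finset.mem_univ i)⟩

lemma norm_update_add_le {x : Fin K → State n} {R c : ℝ} (hR : ∀ i, ‖x i‖ + (c + 1) ≤ R)
    {j : Fin K} {y : State n} (hy : dist y (x j) < 1) (i : Fin K) :
    ‖Function.update x j y i‖ + c ≤ R := by
  rcases eq_or_ne i j with rfl | hi
  · rw [Function.update_self]
    rw [dist_eq_norm] at hy
    have := norm_le_norm_add_norm_sub' y (x i)
    linarith [hR i]
  · rw [Function.update_of_ne hi]
    linarith [hR i]

variable [NeZero K]

lemma integral_mollified_update_sub (k : ℕ) (x : Fin K → State n) (j : Fin K) (y : State n)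
    {f : State n → ℝ} (hf : Continuous f) :
    ∫ ξ, f ξ ∂(mollified k (Function.update x j y) : Measure (State n)) -
        ∫ ξ, f ξ ∂(mollified k x : Measure (State n)) =
      (K : ℝ)⁻¹ * ∫ ξ, (f (ξ + (y - x j)) - f ξ) ∂(ballAverage k (x j)) := by
  rw [integral_mollified _ _ hf, integral_mollified _ _ hf, ← mul_sub, ← Finset.sum_sub_distrib,
    Finset.sum_eq_single j]
  · have hy : ballAverage k y = (ballAverage k (x j)).map (· + (y - x j)) := by
      rw [map_add_ballAverage, add_sub_cancel]
    have hf' : Continuous fun ξ => f (ξ + (y - x j)) := by fun_prop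
    rw [Function.update_self, hy, integral_map (by fun_prop) hf.aestronglyMeasurable,
      integral_sub (integrable_of_ae_mem_closedBall hf' (ae_ballAverage _ _))
        (integrable_of_ae_mem_closedBall hf (ae_ballAverage _ _))]
  · intro i _ hi
    rw [Function.update_of_ne hi, sub_self]
  · simp

/-- The derivative of a functional along the motion of one atom of an empirical measure. -/
lemma hasGradientAt_update_empirical {G : L2 n → ℝ} {g : L2 n → State n → ℝ}
    {Gbar : ProbabilityMeasure (State n) → ℝ} {W : ProbabilityMeasure (State n) → State n → ℝ}
    (hG : ∀ m, BoundedSupport m → HasGateauxDeriv G m (g m))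
    (hGbar : ∀ m μ, BoundedSupport m → IsDensity m μ → Gbar μ = G m)
    (hW : ∀ m μ, BoundedSupport m → IsDensity m μ → ∀ ξ, W μ ξ = g m ξ)
    (hGc : ∀ R, ContinuousOn Gbar (carriedBy n R))
    (hWd : ∀ R, ∀ μ ∈ carriedBy n R, Differentiable ℝ (W μ))
    (hWc : ∀ R, ContinuousOn
      (fun p : ProbabilityMeasure (State n) × State n => gradient (W p.1) p.2)
      (carriedBy n R ×ˢ Set.univ))
    (x : Fin K → State n) (j : Fin K) :
    HasGradientAt (fun y => Gbar (empirical (Function.update x j y)))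
      ((K : ℝ)⁻¹ • gradient (W (empirical x)) (x j)) (x j) := by
  set L := gradient (W (empirical x)) (x j) with hL
  -- One unit of room for the displacement of the atom, one for the radius of mollification.
  obtain ⟨R, hR⟩ := exists_norm_add_le x (1 + 1)
  have hR₀ : ∀ i, ‖x i‖ + 1 ≤ R := fun i => by linarith [hR i]
  rw [hasGradientAt_iff_isLittleO, isLittleO_iff]
  intro δ hδ
  let path : (ℕ × State n) × unitInterval × State n → ProbabilityMeasure (State n) × State n :=
    fun a => (convexComb a.2.1 (mollified a.1.1 x)
      (mollified a.1.1 (Function.update x j a.1.2)), a.2.2)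
  have hupd : Tendsto (fun y => Function.update x j y) (𝓝 (x j)) (𝓝 x) := by
    simpa using (continuous_const.update j continuous_id :
      Continuous fun y => Function.update x j y).tendsto (x j)
  have hpath : Tendsto path ((atTop ×ˢ 𝓝 (x j)) ×ˢ (⊤ ×ˢ 𝓝 (x j)))
      (𝓝[carriedBy n R ×ˢ Set.univ] (empirical x, x j)) := by
    have hk : Tendsto (fun a : (ℕ × State n) × unitInterval × State n => a.1.1)
      ((atTop ×ˢ 𝓝 (x j)) ×ˢ (⊤ ×ˢ 𝓝 (x j))) atTop := tendsto_fst.comp tendsto_fst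
    have hy : Tendsto (fun a : (ℕ × State n) × unitInterval × State n => a.1.2)
      ((atTop ×ˢ 𝓝 (x j)) ×ˢ (⊤ ×ˢ 𝓝 (x j))) (𝓝 (x j)) := tendsto_snd.comp tendsto_fst
    refine tendsto_nhdsWithin_iff.2 ⟨?_, ?_⟩
    · rw [nhds_prod_eq]
      exact (tendsto_convexComb (tendsto_mollified hk tendsto_const_nhds)
        (tendsto_mollified hk (hupd.comp hy))).prodMk (tendsto_snd.comp tendsto_snd)
    · filter_upwards [hy.eventually (Metric.ball_mem_nhds _ one_pos)] with a ha
      exact ⟨convexComb_mem_carriedBy (mollified_mem_carriedBy hR₀)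
        (mollified_mem_carriedBy (norm_update_add_le hR ha)) _, trivial⟩
  have hmem : (empirical x, x j) ∈ carriedBy n R ×ˢ (Set.univ : Set (State n)) :=
    ⟨empirical_mem_carriedBy fun i => by linarith [hR i], trivial⟩
  have hev := ((hWc R _ hmem).tendsto.comp hpath).eventually (Metric.closedBall_mem_nhds _ hδ)
  -- The gradient is within `δ` of `L` for large `k`, for `y` and the evaluation point near `x j`,
  -- and for every `t`, since `t` runs along the filter `⊤`. Splitting the product filter makes
  -- these thresholds independent of one another: `y` is fixed before `k` tends to infinity.
  obtain ⟨pa, hpa, pb, hpb, hab⟩ := eventually_prod_iff.1 hev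
  obtain ⟨pk, hpk, py, hpy, hky⟩ := eventually_prod_iff.1 hpa
  obtain ⟨pt, hpt, pz, hpz, htz⟩ := eventually_prod_iff.1 hpb
  rw [eventually_top] at hpt
  obtain ⟨r, hr, hball⟩ := Metric.eventually_nhds_iff_ball.1 hpz
  filter_upwards [hpy, Metric.ball_mem_nhds (x j) (half_pos hr),
    Metric.ball_mem_nhds (x j) one_pos] with y hy hyr hy1
  have hlim : Tendsto (fun k : ℕ => |Gbar (mollified k (Function.update x j y)) -
      Gbar (mollified k x) - (K : ℝ)⁻¹ * inner ℝ L (y - x j)|) atTop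
      (𝓝 |Gbar (empirical (Function.update x j y)) - Gbar (empirical x) -
        (K : ℝ)⁻¹ * inner ℝ L (y - x j)|) := by
    have aux : ∀ z : Fin K → State n, (∀ i, ‖z i‖ + 1 ≤ R) →
        Tendsto (fun k => Gbar (mollified k z)) atTop (𝓝 (Gbar (empirical z))) := by
      intro z hz
      refine (hGc R _ (empirical_mem_carriedBy fun i => by linarith [hz i])).tendsto.comp
        (tendsto_nhdsWithin_iff.2 ⟨tendsto_mollified tendsto_id tendsto_const_nhds, ?_⟩)
      exact .of_forall fun k => mollified_mem_carriedBy hz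
    exact (((aux _ (norm_update_add_le hR hy1)).sub (aux _ hR₀)).sub_const _).abs
  have hbound : |Gbar (empirical (Function.update x j y)) - Gbar (empirical x) -
      (K : ℝ)⁻¹ * inner ℝ L (y - x j)| ≤ (K : ℝ)⁻¹ * (δ * ‖y - x j‖) := by
    refine le_of_tendsto hlim ?_
    filter_upwards [hpk, (tendsto_one_div_add_atTop_nhds_zero_nat (𝕜 := ℝ)).eventually
      (gt_mem_nhds (half_pos hr))] with k hk hkr
    have hm₀ : mollified k x ∈ carriedBy n R := mollified_mem_carriedBy hR₀
    have hm₁ : mollified k (Function.update x j y) ∈ carriedBy n R :=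
      mollified_mem_carriedBy (norm_update_add_le hR hy1)
    have hmt := convexComb_mem_carriedBy hm₀ hm₁
    refine abs_sub_sub_le_of_gateaux hG hGbar hW (boundedSupport_mollifiedDensity k x)
      (boundedSupport_mollifiedDensity k _) (hasL2Density_mollifiedDensity k x)
      (hasL2Density_mollifiedDensity k _)
      (fun t => integrable_of_mem_carriedBy hm₀ (hWd R _ (hmt t)).continuous)
      (fun t => integrable_of_mem_carriedBy hm₁ (hWd R _ (hmt t)).continuous) (fun t => ?_)
    set w := W (convexComb t (mollified k x) (mollified k (Function.update x j y))) with hw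
    have hwd : Differentiable ℝ w := hWd R _ (hmt t)
    have hwc := hwd.continuous
    have hgrad : ∀ z ∈ Metric.ball (x j) r, ‖gradient w z - L‖ ≤ δ := by
      intro z hz
      have := hab (hky hk hy) (htz (hpt t) (hball z hz))
      rwa [dist_eq_norm] at this
    rw [integral_mollified_update_sub k x j y hwc, ← mul_sub, abs_mul,
      abs_of_nonneg (by positivity : (0 : ℝ) ≤ (K : ℝ)⁻¹)]
    gcongr
    have hint : Integrable (fun ξ => w (ξ + (y - x j)) - w ξ) (ballAverage k (x j)) :=
      integrable_of_ae_mem_closedBall (by fun_prop) (ae_ballAverage _ _)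
    have := norm_integral_le_of_norm_le_const (μ := ballAverage k (x j))
      (f := fun ξ => w (ξ + (y - x j)) - w ξ - inner ℝ L (y - x j)) (C := δ * ‖y - x j‖) (by
        -- Both the radius of mollification and the displacement are below `r / 2`, so the
        -- translated point stays in the convex ball where the gradient bound holds.
        filter_upwards [ae_ballAverage k (x j)] with ξ hξ
        have hξ' : ξ ∈ Metric.ball (x j) (r / 2) := hξ.trans_lt hkr
        have hξr : ξ ∈ Metric.ball (x j) r := Metric.ball_subset_ball (by linarith) hξ'
        have hξy : ξ + (y - x j) ∈ Metric.ball (x j) r := by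
          rw [mem_ball_iff_norm] at hξ' hyr ⊢
          calc ‖ξ + (y - x j) - x j‖ = ‖(ξ - x j) + (y - x j)‖ := by congr 1; abel
            _ < r := (norm_add_le _ _).trans_lt (by linarith)
        have := (convex_ball (x j) r).norm_image_sub_le_of_norm_fderiv_le'
          (φ := InnerProductSpace.toDual ℝ (State n) L) (fun z _ => hwd z) (fun z hz => by
            rw [← toDual_gradient, ← map_sub, LinearIsometryEquiv.norm_map]
            exact hgrad z hz) hξr hξy
        simpa using this)
    rw [integral_sub hint (integrable_const _)] at this
    simpa using this
  rw [Function.update_eq_self, Real.norm_eq_abs, inner_smul_left]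
  refine hbound.trans ?_
  have hK : (K : ℝ)⁻¹ ≤ 1 := inv_le_one_of_one_le₀ (by exact_mod_cast NeZero.one_le)
  exact mul_le_of_le_one_left (by positivity) hK

end

/-! ### Traces, Hessians and compactness -/

section

variable {n : ℕ}

lemma tr_zero : tr (0 : State n →L[ℝ] State n) = 0 := by simp [tr]

lemma tr_add (A B : State n →L[ℝ] State n) : tr (A + B) = tr A + tr B := by simp [tr]

lemma tr_smul (c : ℝ) (A : State n →L[ℝ] State n) : tr (c • A) = c * tr A := by simp [tr]

lemma tr_eq_sum_inner (A : State n →L[ℝ] State n) :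
    tr A = ∑ i, inner ℝ (EuclideanSpace.basisFun (Fin n) ℝ i)
      (A (EuclideanSpace.basisFun (Fin n) ℝ i)) :=
  LinearMap.trace_eq_sum_inner _ _

lemma tr_adjoint (A : State n →L[ℝ] State n) : tr (ContinuousLinearMap.adjoint A) = tr A := by
  rw [tr_eq_sum_inner, tr_eq_sum_inner]
  refine Finset.sum_congr rfl fun i _ => ?_
  rw [ContinuousLinearMap.adjoint_inner_right, real_inner_comm]

lemma abs_tr_le (A : State n →L[ℝ] State n) : |tr A| ≤ n * ‖A‖ := by
  rw [tr_eq_sum_inner]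
  refine (Finset.abs_sum_le_sum_abs _ _).trans ?_
  calc _ ≤ ∑ _i : Fin n, ‖A‖ := Finset.sum_le_sum fun i _ => by
        have h := (EuclideanSpace.basisFun (Fin n) ℝ).orthonormal.1 i
        refine (abs_real_inner_le_norm _ _).trans ?_
        rw [h, one_mul]
        exact (A.le_opNorm _).trans_eq (by rw [h, mul_one])
    _ = n * ‖A‖ := by simp

lemma hasFDerivAt_gradient {f : State n → ℝ} (hf : ContDiff ℝ 2 f) (ξ : State n) :
    HasFDerivAt (gradient f) (hessian f ξ) ξ := by
  refine DifferentiableAt.hasFDerivAt ?_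
  have h1 : Differentiable ℝ (fderiv ℝ f) :=
    (hf.fderiv_right (m := 1) (by norm_num)).differentiable (by norm_num)
  let e : StrongDual ℝ (State n) ≃L[ℝ] State n :=
    (InnerProductSpace.toDual ℝ (State n)).symm.toContinuousLinearEquiv
  exact e.differentiable.differentiableAt.comp ξ (h1 ξ)

lemma laplacian_eq_tr_hessian {f : State n → ℝ} (hf : ContDiff ℝ 2 f) (ξ : State n) :
    Laplacian.laplacian f ξ = tr (hessian f ξ) := by
  rw [InnerProductSpace.laplacian_eq_iteratedFDeriv_orthonormalBasis f
    (EuclideanSpace.basisFun (Fin n) ℝ), tr_eq_sum_inner]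
  refine Finset.sum_congr rfl fun i _ => ?_
  set v := EuclideanSpace.basisFun (Fin n) ℝ i
  have h1 : DifferentiableAt ℝ (fderiv ℝ f) ξ :=
    (hf.fderiv_right (m := 1) (by norm_num)).differentiable (by norm_num) ξ
  have h2 : HasFDerivAt (fun z => fderiv ℝ f z v)
      ((innerSL ℝ v).comp (hessian f ξ)) ξ := by
    have := (innerSL ℝ v).hasFDerivAt.comp ξ (hasFDerivAt_gradient hf ξ)
    refine this.congr_of_eventuallyEq (.of_forall fun z => ?_)
    simp [inner_gradient_right]
  have h3 : HasFDerivAt (fun z => fderiv ℝ f z v) ((fderiv ℝ (fderiv ℝ f) ξ).flip v) ξ := by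
    simpa using h1.hasFDerivAt.clm_apply (hasFDerivAt_const v ξ)
  rw [iteratedFDeriv_two_apply]
  simpa using DFunLike.congr_fun (h3.unique h2) v

/-- The probability measures on a compact ball form a compact space, and push-forward along the
inclusion is weakly continuous; its range is this set. -/
lemma isCompact_carriedBy (R : ℝ) : IsCompact (carriedBy n R) := by
  let B := Metric.closedBall (0 : State n) R
  have hB : MeasurableSet B := Metric.isClosed_closedBall.measurableSet
  have : CompactSpace B := isCompact_iff_compactSpace.1 (isCompact_closedBall _ _)
  have hc := ProbabilityMeasure.continuous_map (Ω := B) (Ω' := State n)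
    (f := Subtype.val) continuous_subtype_val
  convert isCompact_range hc
  ext μ
  constructor
  · intro hμ
    have hμ' : ∀ᵐ ξ ∂(μ : Measure (State n)), ξ ∈ B := hμ
    have hmap : ((μ : Measure (State n)).comap (Subtype.val : B → State n)).map Subtype.val =
        μ := by
      rw [map_comap_subtype_coe hB, Measure.restrict_eq_self_of_ae_mem hμ']
    have : IsProbabilityMeasure ((μ : Measure (State n)).comap (Subtype.val : B → State n)) := by
      refine ⟨?_⟩
      rw [← Set.preimage_univ (f := (Subtype.val : B → State n)),
        ← Measure.map_apply measurable_subtype_coe MeasurableSet.univ, hmap, measure_univ]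
    exact ⟨⟨_, this⟩, Subtype.ext hmap⟩
  · rintro ⟨ν, rfl⟩
    simp only [carriedBy, Set.mem_ofPred_eq, ProbabilityMeasure.toMeasure_map]
    rw [Measure.map_apply measurable_subtype_coe hB.compl]
    convert measure_empty (μ := (ν : Measure B))
    ext z
    simp

lemma exists_empirical_mem_carriedBy {K : ℕ} [NeZero K] (x : Fin K → State n) :
    ∃ R, empirical x ∈ carriedBy n R := by
  obtain ⟨R, hR⟩ := exists_norm_add_le x 0
  exact ⟨R, empirical_mem_carriedBy fun i => by simpa using hR i⟩

/-! ### Derivatives of `Φ` and the weighted defect -/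

namespace IsSmoothFunctional

variable {F : L2 n → ℝ} {dF : L2 n → State n → ℝ} {d2F : L2 n → State n → State n → ℝ}
  {Fbar : ProbabilityMeasure (State n) → ℝ} {U : ProbabilityMeasure (State n) → State n → ℝ}
  {V : ProbabilityMeasure (State n) → State n → State n → ℝ} {K : ℕ} [NeZero K]

lemma contDiff_U_empirical (h : IsSmoothFunctional F dF d2F Fbar U V) (x : Fin K → State n) :
    ContDiff ℝ 2 (U (empirical x)) :=
  let ⟨R, hR⟩ := exists_empirical_mem_carriedBy x
  h.contDiff_U R _ hR

lemma partialGrad_restrictEmpirical (h : IsSmoothFunctional F dF d2F Fbar U V) (j : Fin K)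
    (x : Fin K → State n) :
    partialGrad (restrictEmpirical Fbar K) j x =
      (K : ℝ)⁻¹ • gradient (U (empirical x)) (x j) :=
  (hasGradientAt_update_empirical h.gateaux h.extend h.extend₁ h.continuousOn_Fbar
    (fun R μ hμ => (h.contDiff_U R μ hμ).differentiable (by norm_num))
    h.continuousOn_gradient_U x j).gradient

lemma hasGradientAt_U_update (h : IsSmoothFunctional F dF d2F Fbar U V)
    (x : Fin K → State n) (j : Fin K) (y ξ : State n) :
    HasGradientAt (fun y => U (empirical (Function.update x j y)) ξ)
      ((K : ℝ)⁻¹ • gradient (V (empirical (Function.update x j y)) ξ) y) y := by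
  have hc₁ : ∀ R, ContinuousOn (fun μ => U μ ξ) (carriedBy n R) := fun R => by
    have hp : Continuous fun μ : ProbabilityMeasure (State n) => (μ, ξ) :=
      Continuous.prodMk_left ξ
    exact (h.continuousOn_U R).comp hp.continuousOn fun μ hμ => ⟨hμ, trivial⟩
  have hc₂ : ∀ R, ContinuousOn
      (fun p : ProbabilityMeasure (State n) × State n => gradient (V p.1 ξ) p.2)
      (carriedBy n R ×ˢ Set.univ) := fun R => by
    have hp : Continuous fun p : ProbabilityMeasure (State n) × State n => (p.1, ξ, p.2) :=
      continuous_fst.prodMk (continuous_const.prodMk continuous_snd)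
    exact (h.continuousOn_gradient_V R).comp hp.continuousOn fun p hp => ⟨hp.1, trivial⟩
  have := hasGradientAt_update_empirical (G := fun m => dF m ξ) (g := fun m => d2F m ξ)
    (Gbar := fun μ => U μ ξ) (W := fun μ => V μ ξ) (fun m hm => h.gateaux₂ m hm ξ)
    (fun m μ hm hμ => h.extend₁ m μ hm hμ ξ) (fun m μ hm hμ => h.extend₂ m μ hm hμ ξ)
    hc₁ (fun R μ hμ => h.differentiable_V R μ hμ ξ) hc₂ (Function.update x j y) j
  simpa only [Function.update_idem, Function.update_self] using this

/-- The increment of `D_ξ U(m)(xᵏ)` splits into a change of measure at the moved point and a change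
of point at the original measure. The former yields the adjoint term, the latter the Hessian, by the
chain rule. -/
lemma partialHess_restrictEmpirical (h : IsSmoothFunctional F dF d2F Fbar U V) (j k : Fin K)
    (x : Fin K → State n) :
    partialHess (restrictEmpirical Fbar K) j k x =
      (K : ℝ)⁻¹ • ((K : ℝ)⁻¹ • ContinuousLinearMap.adjoint
          (mixedDeriv (V (empirical x)) (x k) (x j)) +
        if j = k then hessian (U (empirical x)) (x j) else 0) := by
  have hupd : Continuous fun y => Function.update x j y := continuous_const.update j continuous_id
  have hupd0 : Tendsto (fun y => Function.update x j y) (𝓝 (x j)) (𝓝 x) := by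
    simpa using hupd.tendsto (x j)
  have hD : ∀ y ξ, HasFDerivAt
      (fun ξ => (K : ℝ)⁻¹ • gradient (V (empirical (Function.update x j y)) ξ) y)
      ((K : ℝ)⁻¹ • mixedDeriv (V (empirical (Function.update x j y))) ξ y) ξ := fun y ξ =>
    let ⟨R, hR⟩ := exists_empirical_mem_carriedBy (Function.update x j y)
    (h.differentiable_gradient_V R _ hR y ξ).hasFDerivAt.fun_const_smul (K : ℝ)⁻¹
  have hc : ContinuousAt (fun p : State n × State n =>
      (K : ℝ)⁻¹ • mixedDeriv (V (empirical (Function.update x j p.1))) p.2 p.1) (x j, x k) := by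
    refine Tendsto.const_smul ?_ (K : ℝ)⁻¹
    obtain ⟨R, hR⟩ := exists_norm_add_le x (0 + 1)
    have hmem : (empirical x, x k, x j) ∈
        carriedBy n R ×ˢ (Set.univ : Set (State n × State n)) :=
      ⟨empirical_mem_carriedBy fun i => by linarith [hR i], trivial⟩
    have ht : Tendsto (fun p : State n × State n =>
        (empirical (Function.update x j p.1), p.2, p.1)) (𝓝 (x j, x k))
        (𝓝[carriedBy n R ×ˢ Set.univ] (empirical x, x k, x j)) := by
      have h1 : Tendsto (fun p : State n × State n => p.1) (𝓝 (x j, x k)) (𝓝 (x j)) :=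
        continuous_fst.tendsto _
      have h2 : Tendsto (fun p : State n × State n => p.2) (𝓝 (x j, x k)) (𝓝 (x k)) :=
        continuous_snd.tendsto _
      refine tendsto_nhdsWithin_iff.2 ⟨?_, ?_⟩
      · rw [nhds_prod_eq (x := empirical x), nhds_prod_eq (x := x k)]
        exact (tendsto_empirical (hupd0.comp h1)).prodMk (h2.prodMk h1)
      · filter_upwards [h1.eventually (Metric.ball_mem_nhds _ one_pos)] with p hp
        exact ⟨empirical_mem_carriedBy fun i => by
          simpa using norm_update_add_le hR hp i, trivial⟩
    have := (h.continuousOn_mixedDeriv_V R _ hmem).tendsto.comp ht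
    simpa [ContinuousAt, Function.comp_def] using this
  have hlo := isLittleO_gradient_sub (hasGradientAt_U_update h x j) hD hc
    (fun y => (contDiff_U_empirical h _).differentiable (by norm_num))
  have hζ : HasFDerivAt (fun y => Function.update x j y k)
      (if j = k then ContinuousLinearMap.id ℝ (State n) else 0) (x j) := by
    split_ifs with hjk
    · subst hjk
      simp only [Function.update_self]
      exact hasFDerivAt_id (𝕜 := ℝ) (x j)
    · simpa [Function.update_of_ne (Ne.symm hjk)] using hasFDerivAt_const (x k) (x j)
  -- For `j = k` the evaluation point moves with the atom; the `o`-estimate is uniform near `x k`,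
  -- so it may be evaluated along this curve.
  have hζt : Tendsto (fun y => (y, Function.update x j y k)) (𝓝 (x j)) (𝓝 (x j, x k)) := by
    rw [nhds_prod_eq]
    exact tendsto_id.prodMk (tendsto_pi_nhds.1 hupd0 k)
  have hlo' := hlo.comp_tendsto hζt
  simp only [Function.comp_def, Function.update_eq_self] at hlo'
  have hvar : HasFDerivAt (fun y => gradient (U (empirical (Function.update x j y)))
      (Function.update x j y k) - gradient (U (empirical x)) (Function.update x j y k))
      (ContinuousLinearMap.adjoint
        ((K : ℝ)⁻¹ • mixedDeriv (V (empirical x)) (x k) (x j))) (x j) := by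
    rw [hasFDerivAt_iff_isLittleO]
    simpa using hlo'
  have hfix : HasFDerivAt (fun y => gradient (U (empirical x)) (Function.update x j y k))
      (hessian (U (empirical x)) (x k) ∘L
        if j = k then ContinuousLinearMap.id ℝ (State n) else 0) (x j) := by
    have hg := hasFDerivAt_gradient (contDiff_U_empirical h x) (x k)
    exact HasFDerivAt.comp (g := gradient (U (empirical x)))
      (f := fun y => Function.update x j y k) (x j) (by rwa [Function.update_eq_self]) hζ
  have hsum := (hvar.add hfix).const_smul (K : ℝ)⁻¹
  unfold partialHess
  simp_rw [partialGrad_restrictEmpirical h]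
  refine (hsum.congr_of_eventuallyEq (.of_forall fun y => ?_)).fderiv.trans ?_
  · simp
  · congr 2
    · simp
    · split_ifs with hjk
      · rw [hjk]; rfl
      · simp

/-- The diagonal Hessians of `U` reproduce the integral exactly, leaving only the change of `U`
caused by the motion of its own atom. -/
lemma weightedDefect_eq (h : IsSmoothFunctional F dF d2F Fbar U V)
    (σ : State n → (State n →L[ℝ] State n)) (x : Fin K → State n) :
    weightedDefect Fbar U σ K x = -((K : ℝ)⁻¹ * ((K : ℝ)⁻¹ * ∑ j, tr (diffusion σ (x j) ∘L
      ContinuousLinearMap.adjoint (mixedDeriv (V (empirical x)) (x j) (x j))))) := by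
  unfold weightedDefect
  simp_rw [integral_empirical, h.partialHess_restrictEmpirical, if_true,
    ContinuousLinearMap.comp_smul, ContinuousLinearMap.comp_add, ContinuousLinearMap.comp_smul,
    tr_smul, tr_add, tr_smul, ← Finset.mul_sum, Finset.sum_add_distrib, ← Finset.mul_sum,
    smul_eq_mul]
  ring

lemma abs_weightedDefect_le (h : IsSmoothFunctional F dF d2F Fbar U V)
    {σ : State n → (State n →L[ℝ] State n)} {x : Fin K → State n} {S M : ℝ}
    (hS : ∀ j, ‖σ (x j)‖ ≤ S)
    (hM : ∀ j, ‖mixedDeriv (V (empirical x)) (x j) (x j)‖ ≤ M) :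
    |weightedDefect Fbar U σ K x| ≤ n * (S * S * M) / K := by
  have hK : (0 : ℝ) < K := by exact_mod_cast NeZero.pos K
  rw [h.weightedDefect_eq, abs_neg, abs_mul, abs_mul, abs_of_pos (inv_pos.2 hK)]
  have hsum : |∑ j, tr (diffusion σ (x j) ∘L
      ContinuousLinearMap.adjoint (mixedDeriv (V (empirical x)) (x j) (x j)))| ≤
      K * (n * (S * S * M)) := by
    refine (Finset.abs_sum_le_sum_abs _ _).trans ?_
    calc _ ≤ ∑ _j : Fin K, n * (S * S * M) := Finset.sum_le_sum fun j _ => by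
          have hS0 : 0 ≤ S := (norm_nonneg _).trans (hS j)
          refine (abs_tr_le _).trans ?_
          gcongr
          refine (ContinuousLinearMap.opNorm_comp_le _ _).trans ?_
          gcongr
          · refine (ContinuousLinearMap.opNorm_comp_le _ _).trans ?_
            rw [LinearIsometryEquiv.norm_map]
            exact mul_le_mul (hS j) (hS j) (norm_nonneg _) hS0
          · rw [LinearIsometryEquiv.norm_map]
            exact hM j
      _ = K * (n * (S * S * M)) := by simp
  calc _ ≤ (K : ℝ)⁻¹ * ((K : ℝ)⁻¹ * (K * (n * (S * S * M)))) := by gcongr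
    _ = n * (S * S * M) / K := by field_simp

end IsSmoothFunctional

end

end MeanField

end

/-! ### The three conclusions -/

theorem proposition6p1 {n : ℕ}
    (F : MeanField.L2 n → ℝ)
    (dF : MeanField.L2 n → MeanField.State n → ℝ)
    (d2F : MeanField.L2 n → MeanField.State n → MeanField.State n → ℝ)
    (Fbar : ProbabilityMeasure (MeanField.State n) → ℝ)
    (U : ProbabilityMeasure (MeanField.State n) → MeanField.State n → ℝ)
    (V : ProbabilityMeasure (MeanField.State n) → MeanField.State n → MeanField.State n → ℝ)
    (hF : MeanField.IsSmoothFunctional F dF d2F Fbar U V)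
    (hΦ : ∀ (K : ℕ) [NeZero K], ContDiff ℝ 2 (MeanField.restrictEmpirical Fbar K)) :
    (∀ (B : MeanField.State n → MeanField.State n) (K : ℕ) [NeZero K]
        (x : Fin K → MeanField.State n),
      ∫ ξ, inner ℝ (gradient (U (MeanField.empirical x)) ξ) (B ξ)
          ∂(MeanField.empirical x : Measure (MeanField.State n)) =
        ∑ j, inner ℝ (MeanField.partialGrad (MeanField.restrictEmpirical Fbar K) j x) (B (x j))) ∧
    (∀ (K : ℕ) [NeZero K] (x : Fin K → MeanField.State n),
      (∫ ξ, Laplacian.laplacian (U (MeanField.empirical x)) ξ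
          ∂(MeanField.empirical x : Measure (MeanField.State n))) +
        (∫ ξ, ∫ η, MeanField.tr (MeanField.mixedDeriv (V (MeanField.empirical x)) ξ η)
          ∂(MeanField.empirical x : Measure (MeanField.State n))
          ∂(MeanField.empirical x : Measure (MeanField.State n))) =
        ∑ j, ∑ k,
          MeanField.tr (MeanField.partialHess (MeanField.restrictEmpirical Fbar K) j k x)) ∧
    (∀ σ : MeanField.State n → (MeanField.State n →L[ℝ] MeanField.State n), Continuous σ →
      (∀ R : ℝ, ∃ C : ℝ, ∀ (K : ℕ) [NeZero K] (x : Fin K → MeanField.State n),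
        (∀ j, ‖x j‖ ≤ R) → |MeanField.weightedDefect Fbar U σ K x| ≤ C / K) ∧
      ((∃ M : ℝ, (∀ ξ, ‖σ ξ‖ ≤ M) ∧
          ∀ R, ∀ μ ∈ MeanField.carriedBy n R, ∀ ξ η, ‖MeanField.mixedDeriv (V μ) ξ η‖ ≤ M) →
        ∃ C : ℝ, ∀ (K : ℕ) [NeZero K] (x : Fin K → MeanField.State n),
          |MeanField.weightedDefect Fbar U σ K x| ≤ C / K)) := by
  refine ⟨fun B K _ x => ?_, fun K _ x => ?_, fun σ hσ => ⟨fun R => ?_, ?_⟩⟩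
  · simp_rw [MeanField.integral_empirical, hF.partialGrad_restrictEmpirical, inner_smul_left,
      ← Finset.mul_sum]
    rfl
  · simp_rw [MeanField.integral_empirical,
      MeanField.laplacian_eq_tr_hessian (hF.contDiff_U_empirical x),
      hF.partialHess_restrictEmpirical, MeanField.tr_smul, MeanField.tr_add, MeanField.tr_smul,
      MeanField.tr_adjoint, smul_eq_mul, ← Finset.mul_sum, Finset.sum_add_distrib,
      ← Finset.mul_sum, apply_ite MeanField.tr, MeanField.tr_zero, Finset.sum_ite_eq,
      Finset.mem_univ, if_true]
    -- The second derivative in `(j, k)` carries the mixed derivative at `(xᵏ, xʲ)`, the reverse of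
    -- the order in the double integral.
    rw [Finset.sum_comm]
    ring
  -- One compact set contains the empirical measures for all `K` at once, so the bound does not
  -- depend on `K`.
  · have hc : IsCompact (MeanField.carriedBy n R ×ˢ (Metric.closedBall (0 : MeanField.State n) R ×ˢ
        Metric.closedBall (0 : MeanField.State n) R)) :=
      (MeanField.isCompact_carriedBy R).prod
        ((isCompact_closedBall _ _).prod (isCompact_closedBall _ _))
    obtain ⟨M, hM⟩ := hc.exists_bound_of_continuousOn
      ((hF.continuousOn_mixedDeriv_V R).mono (Set.prod_mono_right (Set.subset_univ _)))
    obtain ⟨S, hS⟩ := (isCompact_closedBall (0 : MeanField.State n) R).exists_bound_of_continuousOn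
      hσ.continuousOn
    refine ⟨n * (S * S * M), fun K _ x hx => hF.abs_weightedDefect_le
      (fun j => hS _ (by simpa using hx j)) (fun j => hM (_, _, _) ⟨?_, ?_, ?_⟩)⟩
    · exact MeanField.empirical_mem_carriedBy hx
    · simpa using hx j
    · simpa using hx j
  · rintro ⟨M, hσM, hVM⟩
    refine ⟨n * (M * M * M), fun K _ x => hF.abs_weightedDefect_le (fun j => hσM _) fun j => ?_⟩
    obtain ⟨R, hR⟩ := MeanField.exists_empirical_mem_carriedBy x
    exact hVM R _ hR _ _
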